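/- Let $X$ be a regular $T_1$ topological space. Let $CL(X)$ be the set of all non-empty closed subsets of $X$ with the Vietoris topology $\mathbb V$, whose base consists of the sets $\langle U_1,\dots,U_k\rangle=\{H\in CL(X): H\subset\bigcup_{i=1}^k U_i,\ H\cap U_j\neq\emptyset \text{ for } 1\le j\le k\}$, where $k\ge 1$ and $U_1,\dots,U_k$ are open in $X$. Then the following statements are equivalent: 1. $(CL(X),\mathbb V)$ is semi-stratifiable; 2. $(CL(X),\mathbb V)$ is quasi-developable; 3. $(CL(X),\mathbb V)$ is a $D_1$-space; 4. $(CL(X),\mathbb V)$ is symmetrizable; 5. $X$ is compact and metrizable. Here a space $Y$ is *semi-stratifiable* if one can assign to each $n\in\mathbb N$ and each open $U\subset Y$ a closed set $F(n,U)$ such that $U=\bigcup_{n}F(n,U)$, and $F(n,V)\subset F(n,U)$ whenever $V\subset U$. It is *quasi-developable* if there is a sequence $(\mathscr U_n)$ of families of open subsets of $Y$ such that for every open $U$ and every $x\in U$ there is $n$ with $x\in \mathrm{st}(x,\mathscr U_n)\subset U$, where $\mathrm{st}(x,\mathscr U)=\bigcup\{W\in\mathscr U: x\in W\}$. It is a *$D_1$-space*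 if every non-empty closed $A\subset Y$ has a countable base of open neighbourhoods, i.e. a countable family $\mathscr B$ of open sets containing $A$ such that every open set containing $A$ contains a member of $\mathscr B$. It is *symmetrizable* if there is a function $d:Y\times Y\to[0,\infty)$ with $d(x,y)=0$ if and only if $x=y$, and $d(x,y)=d(y,x)$, such that a set $U\subset Y$ is open if and only if for every $x\in U$ there is $\varepsilon>0$ with $\{y: d(x,y)<\varepsilon\}\subset U$. -/

import Mathlib

open Set TopologicalSpace

universe u

namespace VietorisHyperspace

/-- `CL X` is the set of all non-empty closed subsets of the topological space `X`. -/
def CL (X : Type u) [TopologicalSpace X] : Type u :=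
  {A : Set X // A.Nonempty ∧ IsClosed A}

/-- The Vietoris topology on `CL X`: the topology generated by the sets
`{H | H ⊆ U}` and `{H | H ∩ U ≠ ∅}` for `U` open in `X`
(Mathlib's Vietoris topology on `Set X`, restricted to the non-empty closed sets).
By `CL.isTopologicalBasis` below, the sets `⟨U₁, …, Uₖ⟩` form a base of it. -/
instance CL.instTopologicalSpace (X : Type u) [TopologicalSpace X] : TopologicalSpace (CL X) :=
  TopologicalSpace.induced (fun A : CL X => A.1) (TopologicalSpace.vietoris X)

/-- The set `⟨U₁, …, Uₖ⟩` of all `H` in `CL X` that are contained in `U₁ ∪ … ∪ Uₖ` and meet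
every `Uⱼ`, for a family `𝓤 = {U₁, …, Uₖ}` of subsets of `X`. -/
def CL.box {X : Type u} [TopologicalSpace X] (𝓤 : Set (Set X)) : Set (CL X) :=
  {H | H.1 ⊆ ⋃₀ 𝓤 ∧ ∀ U ∈ 𝓤, (H.1 ∩ U).Nonempty}

/-- The sets `⟨U₁, …, Uₖ⟩`, with `k ≥ 1` and all `Uⱼ` open, form a base of the Vietoris topology. -/
theorem CL.isTopologicalBasis (X : Type u) [TopologicalSpace X] :
    IsTopologicalBasis
      {S : Set (CL X) | ∃ 𝓤 : Set (Set X),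
        𝓤.Finite ∧ 𝓤.Nonempty ∧ (∀ U ∈ 𝓤, IsOpen U) ∧ S = CL.box 𝓤} := by
  let _ : TopologicalSpace (Set X) := TopologicalSpace.vietoris X
  have h := (TopologicalSpace.vietoris.isTopologicalBasis (α := X)).induced
    (fun A : CL X => A.1)
  refine (congrArg IsTopologicalBasis (Set.ext fun S => ?_)).mpr h
  constructor
  · rintro ⟨𝓤, hf, -, ho, rfl⟩
    exact ⟨_, ⟨𝓤, ⟨hf, ho⟩, rfl⟩, rfl⟩
  · rintro ⟨_, ⟨𝓤, ⟨hf, ho⟩, rfl⟩, rfl⟩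
    rcases 𝓤.eq_empty_or_nonempty with rfl | hne
    · refine ⟨{∅}, finite_singleton _, singleton_nonempty _, by simp, ?_⟩
      ext H
      have hH := H.2.1.ne_empty
      simp [CL.box, hH]
    · exact ⟨𝓤, hf, hne, ho, rfl⟩

/-- A space is semi-stratifiable if there is a map `F` assigning to each `n` and each open `U`
a closed set `F n U` such that `U = ⋃ n, F n U`, and `F n V ⊆ F n U` whenever `V ⊆ U`. -/
def SemiStratifiable (Y : Type u) [TopologicalSpace Y] : Prop :=
  ∃ F : ℕ → Opens Y → Closeds Y,
    (∀ U : Opens Y, (U : Set Y) = ⋃ n, (F n U : Set Y)) ∧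
    ∀ (n : ℕ) (V U : Opens Y), V ≤ U → F n V ≤ F n U

/-- The star `st(x, 𝓤)`: the union of all members of `𝓤` that contain `x`. -/
def starAt {Y : Type u} (x : Y) (𝓤 : Set (Set Y)) : Set Y :=
  ⋃₀ {U ∈ 𝓤 | x ∈ U}

/-- A space is quasi-developable if there is a sequence `𝓤 n` of families of open sets such that
for every open `U` and every `x ∈ U` there is `n` with `x ∈ st(x, 𝓤 n) ⊆ U`. -/
def QuasiDevelopable (Y : Type u) [TopologicalSpace Y] : Prop :=
  ∃ 𝓤 : ℕ → Set (Set Y),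
    (∀ n, ∀ U ∈ 𝓤 n, IsOpen U) ∧
    ∀ (x : Y) (U : Set Y), IsOpen U → x ∈ U →
      ∃ n, x ∈ starAt x (𝓤 n) ∧ starAt x (𝓤 n) ⊆ U

/-- A subset `A` of a space has countable character if it has a countable base of open
neighbourhoods. -/
def HasCountableCharacter {Y : Type u} [TopologicalSpace Y] (A : Set Y) : Prop :=
  ∃ 𝓑 : Set (Set Y), 𝓑.Countable ∧ (∀ B ∈ 𝓑, IsOpen B ∧ A ⊆ B) ∧
    ∀ V : Set Y, IsOpen V → A ⊆ V → ∃ B ∈ 𝓑, B ⊆ V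

/-- A space is a `D₁`-space if every non-empty closed subset has countable character. -/
def IsD1Space (Y : Type u) [TopologicalSpace Y] : Prop :=
  ∀ A : Set Y, A.Nonempty → IsClosed A → HasCountableCharacter A

/-- `d` is a symmetric on `Y`: a non-negative real function with `d x y = 0` exactly when
`x = y`, and `d x y = d y x`. No triangle inequality is required. -/
def IsSymmetric {Y : Type u} (d : Y → Y → ℝ) : Prop :=
  (∀ x y, 0 ≤ d x y) ∧ (∀ x y, d x y = 0 ↔ x = y) ∧ ∀ x y, d x y = d y x

/-- A space is symmetrizable if there is a symmetric `d` on it such that a set `U` is open if and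
only if every `x ∈ U` has a ball `{y | d x y < ε}`, `ε > 0`, contained in `U`. -/
def Symmetrizable (Y : Type u) [TopologicalSpace Y] : Prop :=
  ∃ d : Y → Y → ℝ, IsSymmetric d ∧
    ∀ U : Set Y, IsOpen U ↔ ∀ x ∈ U, ∃ ε > 0, {y | d x y < ε} ⊆ U

end VietorisHyperspace

/-!
# When the Vietoris hyperspace is a generalized metric space

If `X` is compact and metrizable, then `CL X` is the space of non-empty compact subsets of `X`, which
is compact and metrizable, and such a space has all four properties.

Conversely, all four properties pass to closed subspaces. If `X` is not countably compact, it contains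
a closed discrete copy of `ℕ`, so that `CL X` contains a closed copy of `CL ℕ`. A basic neighbourhood
of `H` in `CL ℕ` consists of the sets between some finite `F ⊆ H` and `H`. A fusion argument shows that
`CL ℕ` is not a countable union of pieces on which each `H` has a neighbourhood containing only
supersets of `H` (`CL.not_cover_of_forall_exists_nhds`); a semi-stratification, a quasi-development or
a symmetric would produce such pieces, namely the `H` for which the `n`-th set assigned to `H` works
for the open set `{K | K ⊆ H}`. The final segments of `ℕ` form a closed set without countable
character, so `CL ℕ` is not a `D₁`-space either. Hence `X` is countably compact.

Next, `X` itself is semi-stratifiable. It embeds in `CL X` as the closed set of singletons.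
* If `CL X` is quasi-developable, then so is `X`; moreover `CL X` is first countable, which makes each
  closed subset of `X` a `Gδ` set, and these two facts suffice (`QuasiDevelopable.semiStratifiable`).
* If `CL X` is a `D₁`-space, a countable base of neighbourhoods of the set of singletons, tested on
  the sets `{x, y}`, gives the semi-stratification (`IsD1Space.semiStratifiable_of_CL`).
* If `CL X` is symmetrizable, then so is `X`. Countable compactness makes `X` first countable
  (`IsSymmetric.isCountablyGenerated_nhds`), so balls are neighbourhoods of their centres, and these
  give the semi-stratification (`Symmetrizable.semiStratifiable`).

Finally, a countably compact semi-stratifiable Hausdorff space is Lindelöf, hence compact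
(`SemiStratifiable.compactSpace`), and its diagonal has a countable base of neighbourhoods, which
makes it metrizable (`SemiStratifiable.metrizableSpace`).
-/

namespace VietorisHyperspace

open Topology Filter

/-! ### The hyperspace `CL X` -/

namespace CL

theorem isEmbedding_coe (X : Type*) [TopologicalSpace X] :
    @IsEmbedding (CL X) (Set X) _ (TopologicalSpace.vietoris X) (fun H => H.1) :=
  let _ : TopologicalSpace (Set X) := TopologicalSpace.vietoris X
  ⟨⟨rfl⟩, Subtype.val_injective⟩

theorem isOpen_subset {X : Type*} [TopologicalSpace X] {U : Set X} (hU : IsOpen U) :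
    IsOpen {H : CL X | H.1 ⊆ U} :=
  ⟨_, IsOpen.powerset_vietoris hU, rfl⟩

theorem isOpen_inter_nonempty {X : Type*} [TopologicalSpace X] {U : Set X} (hU : IsOpen U) :
    IsOpen {H : CL X | (H.1 ∩ U).Nonempty} :=
  ⟨_, vietoris.isOpen_inter_nonempty_of_isOpen hU, rfl⟩

/-- The map `H ↦ f '' H` from `CL X` to `CL Y` induced by a closed embedding `f`. -/
def image {X Y : Type*} [TopologicalSpace X] [TopologicalSpace Y] {f : X → Y}
    (hf : IsClosedEmbedding f) (H : CL X) : CL Y :=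
  ⟨f '' H.1, H.2.1.image f, hf.isClosedMap _ H.2.2⟩

/-- The closed subsets of `Y` inside a closed subspace `X` form a closed copy of `CL X`. -/
theorem isClosedEmbedding_image {X Y : Type*} [TopologicalSpace X] [TopologicalSpace Y] {f : X → Y}
    (hf : IsClosedEmbedding f) : IsClosedEmbedding (image hf) := by
  let _ : TopologicalSpace (Set X) := TopologicalSpace.vietoris X
  let _ : TopologicalSpace (Set Y) := TopologicalSpace.vietoris Y
  have h : IsEmbedding ((fun K : CL Y => K.1) ∘ image hf) :=
    hf.isEmbedding.image_vietoris.comp (isEmbedding_coe X)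
  refine ⟨((isEmbedding_coe Y).of_comp_iff).1 h, ?_⟩
  have hc : IsClosed {K : CL Y | K.1 ⊆ range f} :=
    IsClosed.preimage (isEmbedding_coe Y).continuous (IsClosed.powerset_vietoris hf.isClosed_range)
  convert hc using 1
  ext K
  constructor
  · rintro ⟨H, rfl⟩
    exact image_subset_range f _
  · intro hK
    have hK' : f '' (f ⁻¹' K.1) = K.1 := image_preimage_eq_of_subset hK
    exact ⟨⟨f ⁻¹' K.1, (Nonempty.of_image (f := f) (by rw [hK']; exact K.2.1)),
      K.2.2.preimage hf.continuous⟩, Subtype.ext hK'⟩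

/-- The map `x ↦ {x}` from `X` to `CL X`. -/
def single {X : Type*} [TopologicalSpace X] [T1Space X] (x : X) : CL X :=
  ⟨{x}, singleton_nonempty x, isClosed_singleton⟩

theorem isClosedEmbedding_single (X : Type*) [TopologicalSpace X] [T2Space X] :
    IsClosedEmbedding (single : X → CL X) := by
  let _ : TopologicalSpace (Set X) := TopologicalSpace.vietoris X
  have h : IsEmbedding ((fun K : CL X => K.1) ∘ (single : X → CL X)) :=
    vietoris.isEmbedding_singleton
  refine ⟨((isEmbedding_coe X).of_comp_iff).1 h, ?_⟩
  have hc : IsClosed ((fun K : CL X => K.1) ⁻¹' range ({·} : X → Set X)) :=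
    (vietoris.isClosedEmbedding_singleton (α := X)).isClosed_range.preimage
      (isEmbedding_coe X).continuous
  convert hc using 1
  ext K
  constructor
  · rintro ⟨x, rfl⟩
    exact ⟨x, rfl⟩
  · rintro ⟨x, hx⟩
    exact ⟨x, Subtype.ext hx⟩

/-- The map `x ↦ {x} ∪ K` from `X` to `CL X`, for a non-empty closed set `K`. -/
def adjoin {X : Type*} [TopologicalSpace X] [T1Space X] (K : CL X) (x : X) : CL X :=
  ⟨{x} ∪ K.1, (singleton_nonempty x).inl, isClosed_singleton.union K.2.2⟩

theorem continuous_adjoin {X : Type*} [TopologicalSpace X] [T1Space X] (K : CL X) :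
    Continuous (adjoin K) := by
  let _ : TopologicalSpace (Set X) := TopologicalSpace.vietoris X
  refine ((isEmbedding_coe X).continuous_iff).2 ?_
  exact vietoris.continuous_union.comp (vietoris.continuous_singleton.prodMk continuous_const)

theorem exists_finite_of_isOpen {X : Type*} [TopologicalSpace X] {O : Set (CL X)} (hO : IsOpen O)
    {H : CL X} (hH : H ∈ O) :
    ∃ F : Set X, F.Finite ∧ F ⊆ H.1 ∧ ∀ K : CL X, F ⊆ K.1 → K.1 ⊆ H.1 → K ∈ O := by
  obtain ⟨_, ⟨𝓤, hfin, -, -, rfl⟩, hHU, hUO⟩ :=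
    (CL.isTopologicalBasis X).exists_subset_of_mem_open hH hO
  have : Nonempty X := H.2.1.to_type
  choose! p hp using hHU.2
  refine ⟨p '' 𝓤, hfin.image p, image_subset_iff.2 fun U hU => (hp U hU).1, fun K hFK hKH => ?_⟩
  exact hUO ⟨hKH.trans hHU.1, fun U hU => ⟨p U, hFK (mem_image_of_mem p hU), (hp U hU).2⟩⟩

theorem compactSpace_and_metrizableSpace {X : Type*} [TopologicalSpace X] [CompactSpace X]
    [MetrizableSpace X] :
    CompactSpace (CL X) ∧ MetrizableSpace (CL X) := by
  let _ : TopologicalSpace (Set X) := TopologicalSpace.vietoris X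
  let _ : MetricSpace X := metrizableSpaceMetric X
  let f : CL X → NonemptyCompacts X := fun H => ⟨⟨H.1, H.2.2.isCompact⟩, H.2.1⟩
  have h : IsEmbedding ((fun K : NonemptyCompacts X => (K : Set X)) ∘ f) := isEmbedding_coe X
  have hf : IsEmbedding f := (NonemptyCompacts.isEmbedding_coe.of_comp_iff).1 h
  have hr : range f = univ :=
    eq_univ_of_forall fun K => ⟨⟨K, K.nonempty, K.isCompact.isClosed⟩, rfl⟩
  exact ⟨(⟨hf, hr ▸ isClosed_univ⟩ : IsClosedEmbedding f).compactSpace, hf.metrizableSpace⟩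

end CL

/-! ### Passing to closed subspaces -/

theorem SemiStratifiable.of_isInducing {Y : Type*} {Z : Type*} [TopologicalSpace Y]
    [TopologicalSpace Z] (h : SemiStratifiable Y) {f : Z → Y} (hf : IsInducing f) :
    SemiStratifiable Z := by
  obtain ⟨F, hF, hmono⟩ := h
  -- `V U` is the largest open set of `Y` with trace inside `U`, hence depends on `U` monotonically.
  let V : Opens Z → Opens Y := fun U => sSup {V | f ⁻¹' V ⊆ U}
  have hV (U : Opens Z) : f ⁻¹' (V U) = U := by
    ext z
    simp only [V, Opens.coe_sSup, mem_preimage, mem_iUnion, mem_ofPred_eq, exists_prop]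
    constructor
    · rintro ⟨W, hW, hz⟩
      exact hW hz
    · intro hz
      obtain ⟨W, hW, hWU⟩ := hf.isOpen_iff.1 U.2
      refine ⟨⟨W, hW⟩, hWU.subset, ?_⟩
      exact hWU.symm.subset hz
  refine ⟨fun n U => ⟨f ⁻¹' (F n (V U)), (F n (V U)).2.preimage hf.continuous⟩, fun U => ?_, ?_⟩
  · conv_lhs => rw [← hV U, hF, preimage_iUnion]
    rfl
  · intro n U W hUW
    have hVV : V U ≤ V W := sSup_le_sSup fun T hT => Subset.trans hT hUW
    exact preimage_mono (f := f) (hmono n _ _ hVV)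

theorem QuasiDevelopable.of_isInducing {Y : Type*} {Z : Type*} [TopologicalSpace Y]
    [TopologicalSpace Z] (h : QuasiDevelopable Y) {f : Z → Y} (hf : IsInducing f) :
    QuasiDevelopable Z := by
  obtain ⟨𝓤, ho, hU⟩ := h
  refine ⟨fun n => (f ⁻¹' ·) '' 𝓤 n, ?_, ?_⟩
  · rintro n _ ⟨W, hW, rfl⟩
    exact (ho n W hW).preimage hf.continuous
  · intro z U hUo hz
    obtain ⟨V, hV, rfl⟩ := hf.isOpen_iff.1 hUo
    obtain ⟨n, ⟨W, ⟨hW, hzW⟩, -⟩, hn⟩ := hU (f z) V hV hz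
    refine ⟨n, ⟨_, ⟨⟨W, hW, rfl⟩, hzW⟩, hzW⟩, ?_⟩
    rintro y ⟨_, ⟨⟨T, hT, rfl⟩, hzT⟩, hy⟩
    exact hn ⟨T, ⟨hT, hzT⟩, hy⟩

theorem IsD1Space.of_isClosedEmbedding {Y : Type*} {Z : Type*} [TopologicalSpace Y]
    [TopologicalSpace Z] (h : IsD1Space Y) {f : Z → Y} (hf : IsClosedEmbedding f) :
    IsD1Space Z := by
  intro A hA hAc
  obtain ⟨𝓑, hc, hB, hbase⟩ := h (f '' A) (hA.image f) (hf.isClosedMap A hAc)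
  refine ⟨(f ⁻¹' ·) '' 𝓑, hc.image _, ?_, ?_⟩
  · rintro _ ⟨B, hB', rfl⟩
    exact ⟨(hB B hB').1.preimage hf.continuous, image_subset_iff.1 (hB B hB').2⟩
  · intro V hV hAV
    obtain ⟨W, hW, rfl⟩ := hf.isInducing.isOpen_iff.1 hV
    obtain ⟨B, hB', hBW⟩ := hbase W hW (image_subset_iff.2 hAV)
    exact ⟨_, ⟨B, hB', rfl⟩, preimage_mono hBW⟩

theorem Symmetrizable.of_isClosedEmbedding {Y : Type*} {Z : Type*} [TopologicalSpace Y]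
    [TopologicalSpace Z] (h : Symmetrizable Y) {f : Z → Y} (hf : IsClosedEmbedding f) :
    Symmetrizable Z := by
  obtain ⟨d, ⟨h0, heq, hsymm⟩, hd⟩ := h
  refine ⟨fun x y => d (f x) (f y), ⟨fun _ _ => h0 _ _, fun x y => ?_, fun _ _ => hsymm _ _⟩, ?_⟩
  · rw [heq, hf.injective.eq_iff]
  · intro U
    constructor
    · intro hU x hx
      obtain ⟨V, hV, rfl⟩ := hf.isInducing.isOpen_iff.1 hU
      obtain ⟨ε, hε, hb⟩ := (hd V).1 hV (f x) hx
      exact ⟨ε, hε, fun y hy => hb hy⟩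
    · intro hU
      have hO : IsOpen (f '' Uᶜ)ᶜ := by
        refine (hd _).2 fun y hy => ?_
        by_cases hyr : y ∈ range f
        · obtain ⟨x, rfl⟩ := hyr
          have hx : x ∈ U := by
            by_contra hx
            exact hy (mem_image_of_mem f hx)
          obtain ⟨ε, hε, hb⟩ := hU x hx
          refine ⟨ε, hε, ?_⟩
          rintro _ hz ⟨z, hzU, rfl⟩
          exact hzU (hb hz)
        · obtain ⟨ε, hε, hb⟩ := (hd _).1 hf.isClosed_range.isOpen_compl y hyr
          exact ⟨ε, hε, hb.trans (compl_subset_compl.2 (image_subset_range f _))⟩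
      have hU' : U = f ⁻¹' (f '' Uᶜ)ᶜ := by
        rw [preimage_compl, preimage_image_eq _ hf.injective, compl_compl]
      rw [hU']
      exact hO.preimage hf.continuous

/-! ### Compact metrizable spaces have all four properties -/

theorem semiStratifiable_of_metrizableSpace (Y : Type*) [TopologicalSpace Y] [MetrizableSpace Y] :
    SemiStratifiable Y := by
  let _ : MetricSpace Y := metrizableSpaceMetric Y
  refine ⟨fun n U => ⟨{x | ∀ y ∉ U, 1 / ((n : ℝ) + 1) ≤ dist x y}, ?_⟩, fun U => ?_, ?_⟩
  · simp only [ofPred_forall]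
    exact isClosed_iInter fun y => isClosed_iInter fun _ =>
      isClosed_le continuous_const (continuous_id.dist continuous_const)
  · refine Subset.antisymm (fun x hx => ?_) (iUnion_subset fun n x hx => ?_)
    · obtain ⟨ε, hε, hb⟩ := Metric.isOpen_iff.1 U.2 x hx
      obtain ⟨n, hn⟩ := exists_nat_one_div_lt hε
      refine mem_iUnion.2 ⟨n, fun y hy => ?_⟩
      by_contra! hlt
      exact hy (hb (by rw [Metric.mem_ball']; linarith))
    · by_contra hxU
      have := hx x hxU
      rw [dist_self] at this
      exact absurd this (not_le.2 Nat.one_div_pos_of_nat)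
  · intro n V U hVU x hx y hy
    exact hx y fun hyV => hy (hVU hyV)

theorem quasiDevelopable_of_metrizableSpace (Y : Type*) [TopologicalSpace Y] [MetrizableSpace Y] :
    QuasiDevelopable Y := by
  let _ : MetricSpace Y := metrizableSpaceMetric Y
  refine ⟨fun n => range fun x => Metric.ball x (1 / ((n : ℝ) + 1)), ?_, fun x U hU hx => ?_⟩
  · rintro n _ ⟨x, rfl⟩
    exact Metric.isOpen_ball
  · obtain ⟨ε, hε, hb⟩ := Metric.isOpen_iff.1 hU x hx
    obtain ⟨n, hn⟩ := exists_nat_one_div_lt (half_pos hε)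
    refine ⟨n, ⟨_, ⟨⟨x, rfl⟩, ?_⟩, ?_⟩, ?_⟩
    iterate 2 exact Metric.mem_ball_self Nat.one_div_pos_of_nat
    rintro y ⟨_, ⟨⟨z, rfl⟩, hxz⟩, hyz⟩
    rw [Metric.mem_ball] at hyz
    rw [Metric.mem_ball'] at hxz
    refine hb (Metric.mem_ball.2 ?_)
    linarith [dist_triangle y z x]

theorem isD1Space_of_metrizableSpace (Y : Type*) [TopologicalSpace Y] [CompactSpace Y]
    [MetrizableSpace Y] : IsD1Space Y := by
  let _ : MetricSpace Y := metrizableSpaceMetric Y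
  intro A _ hA
  refine ⟨range fun n : ℕ => Metric.thickening (1 / ((n : ℝ) + 1)) A, countable_range _, ?_, ?_⟩
  · rintro _ ⟨n, rfl⟩
    exact ⟨Metric.isOpen_thickening, Metric.self_subset_thickening Nat.one_div_pos_of_nat A⟩
  · intro V hV hAV
    obtain ⟨δ, hδ, hb⟩ := hA.isCompact.exists_thickening_subset_open hV hAV
    obtain ⟨n, hn⟩ := exists_nat_one_div_lt hδ
    exact ⟨_, ⟨n, rfl⟩, (Metric.thickening_mono hn.le A).trans hb⟩

theorem symmetrizable_of_metrizableSpace (Y : Type*) [TopologicalSpace Y] [MetrizableSpace Y] :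
    Symmetrizable Y := by
  let _ : MetricSpace Y := metrizableSpaceMetric Y
  refine ⟨dist, ⟨fun _ _ => dist_nonneg, fun _ _ => dist_eq_zero, dist_comm⟩, fun U => ?_⟩
  simp only [Metric.isOpen_iff, Metric.ball, dist_comm]

/-! ### The hyperspace of the discrete space `ℕ` -/

instance : T2Space (CL ℕ) := by
  refine ⟨fun H K hHK => ?_⟩
  have key : ∀ H K : CL ℕ, ¬ H.1 ⊆ K.1 →
      ∃ u v : Set (CL ℕ), IsOpen u ∧ IsOpen v ∧ H ∈ u ∧ K ∈ v ∧ Disjoint u v := by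
    intro H K h
    obtain ⟨a, haH, haK⟩ := not_subset.1 h
    refine ⟨_, _, CL.isOpen_inter_nonempty (isOpen_discrete {a}),
      CL.isOpen_subset (isOpen_discrete {a}ᶜ), ⟨a, haH, rfl⟩, subset_compl_singleton_iff.2 haK, ?_⟩
    rw [Set.disjoint_left]
    rintro L ⟨b, hb, rfl⟩ hL
    exact hL hb rfl
  by_cases h : H.1 ⊆ K.1
  · obtain ⟨u, v, hu, hv, hKu, hHv, huv⟩ :=
      key K H fun h' => hHK (Subtype.ext (h.antisymm h'))
    exact ⟨v, u, hv, hu, hHv, hKu, huv.symm⟩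
  · exact key H K h

instance : FirstCountableTopology (CL ℕ) := by
  refine ⟨fun H => ?_⟩
  have hb : (𝓝 H).HasBasis (fun F : Finset ℕ => (F : Set ℕ) ⊆ H.1)
      (fun F => {K : CL ℕ | (F : Set ℕ) ⊆ K.1 ∧ K.1 ⊆ H.1}) := by
    refine ⟨fun O => ⟨fun hO => ?_, ?_⟩⟩
    · obtain ⟨O', hO'O, hO', hH⟩ := mem_nhds_iff.1 hO
      obtain ⟨F, hF, hFH, h⟩ := CL.exists_finite_of_isOpen hO' hH
      refine ⟨hF.toFinset, by simpa using hFH, fun K hK => hO'O (h K ?_ hK.2)⟩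
      simpa using hK.1
    · rintro ⟨F, hFH, hFO⟩
      refine Filter.mem_of_superset ?_ hFO
      have h1 : ∀ᶠ K in 𝓝 H, ∀ a ∈ F, (K.1 ∩ {a}).Nonempty :=
        (Filter.eventually_all_finset F).2 fun a ha =>
          (CL.isOpen_inter_nonempty (isOpen_discrete {a})).mem_nhds ⟨a, hFH ha, rfl⟩
      filter_upwards [h1, (CL.isOpen_subset (isOpen_discrete H.1)).mem_nhds (Subset.refl H.1)]
        with K hK hKH
      refine ⟨fun a ha => ?_, hKH⟩
      obtain ⟨b, hb, rfl⟩ := hK a ha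
      exact hb
  exact hb.isCountablyGenerated

/-- A fusion argument: if every finite `s` and every infinite `A ⊇ s` can be enlarged, respectively
shrunk, so that no infinite set in between satisfies `P n`, then some infinite set satisfies none of
the `P n`. -/
theorem exists_infinite_forall_not (P : ℕ → Set ℕ → Prop)
    (h : ∀ (n : ℕ) (s A : Set ℕ), s.Finite → A.Infinite → s ⊆ A →
      ∃ s' A' : Set ℕ, s'.Finite ∧ A'.Infinite ∧ s' ⊆ A' ∧ s ⊆ s' ∧ A' ⊆ A ∧
        ∀ y : Set ℕ, y.Infinite → s' ⊆ y → y ⊆ A' → ¬ P n y) :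
    ∃ y : Set ℕ, y.Infinite ∧ ∀ n, ¬ P n y := by
  let C := {c : Set ℕ × Set ℕ // c.1.Finite ∧ c.2.Infinite ∧ c.1 ⊆ c.2}
  have step : ∀ (n : ℕ) (c : C), ∃ c' : C, c.1.1 ⊆ c'.1.1 ∧ c'.1.2 ⊆ c.1.2 ∧
      (∃ a ∈ c'.1.1, n < a) ∧
      ∀ y : Set ℕ, y.Infinite → c'.1.1 ⊆ y → y ⊆ c'.1.2 → ¬ P n y := by
    rintro n ⟨⟨s, A⟩, hs, hA, hsA⟩
    obtain ⟨s', A', hs', hA', hsA', hss', hAA', hP⟩ := h n s A hs hA hsA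
    obtain ⟨a, haA, hna⟩ := hA'.exists_gt n
    exact ⟨⟨(insert a s', A'), hs'.insert a, hA', insert_subset haA hsA'⟩,
      hss'.trans (subset_insert a s'), hAA', ⟨a, mem_insert a s', hna⟩,
      fun y hy hsy => hP y hy ((subset_insert a s').trans hsy)⟩
  choose next hnext using step
  let c : ℕ → C := fun n => Nat.rec ⟨(∅, univ), finite_empty, infinite_univ, empty_subset _⟩ next n
  have hc1 : Monotone fun n => (c n).1.1 := monotone_nat_of_le_succ fun n => (hnext n (c n)).1
  have hc2 : Antitone fun n => (c n).1.2 := antitone_nat_of_succ_le fun n => (hnext n (c n)).2.1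
  have hy : (⋃ n, (c n).1.1).Infinite := by
    refine infinite_of_forall_exists_gt fun n => ?_
    obtain ⟨a, ha, hna⟩ := (hnext n (c n)).2.2.1
    exact ⟨a, mem_iUnion.2 ⟨n + 1, ha⟩, hna⟩
  refine ⟨⋃ n, (c n).1.1, hy, fun n => ?_⟩
  refine (hnext n (c n)).2.2.2 _ hy (subset_iUnion (fun n => (c n).1.1) (n + 1)) ?_
  refine iUnion_subset fun m => ?_
  exact (hc1 (le_max_left m (n + 1))).trans
    ((c _).2.2.2.trans (hc2 (le_max_right m (n + 1))))

/-- `CL ℕ` is not a countable union of pieces `P n` on each of which every `H` has a neighbourhood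
containing only supersets of `H`. The reason is that basic neighbourhoods of an infinite `H` contain
many proper subsets of `H`. -/
theorem CL.not_cover_of_forall_exists_nhds (P : ℕ → CL ℕ → Prop) (hP : ∀ H, ∃ n, P n H)
    (h : ∀ n H, P n H → ∃ O ∈ 𝓝 H, ∀ K ∈ O, P n K → H.1 ⊆ K.1) : False := by
  obtain ⟨y, hy, hyP⟩ := exists_infinite_forall_not
    (fun n y => ∃ H : CL ℕ, H.1 = y ∧ P n H) fun n s A hs hA hsA => by
    by_cases hH : ∃ H : CL ℕ, H.1.Infinite ∧ s ⊆ H.1 ∧ H.1 ⊆ A ∧ P n H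
    · obtain ⟨H, hHi, hsH, hHA, hPH⟩ := hH
      obtain ⟨O, hO, hOP⟩ := h n H hPH
      obtain ⟨O', hO'O, hO', hHO'⟩ := mem_nhds_iff.1 hO
      obtain ⟨F, hF, hFH, hFO⟩ := CL.exists_finite_of_isOpen hO' hHO'
      -- Deleting one more point of `H` keeps a set in the neighbourhood, but not a superset of `H`.
      obtain ⟨a, haH, has⟩ := hHi.exists_notMem_finite (hs.union hF)
      refine ⟨s ∪ F, H.1 \ {a}, hs.union hF, hHi.sdiff (finite_singleton a), ?_,
        subset_union_left, sdiff_subset.trans hHA, ?_⟩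
      · exact subset_sdiff_singleton (union_subset hsH hFH) has
      · rintro _ - hsy hyA ⟨K, rfl, hK⟩
        have hKO := hFO K (subset_union_right.trans hsy) (hyA.trans sdiff_subset)
        exact (hyA (hOP K (hO'O hKO) hK haH)).2 rfl
    · refine ⟨s, A, hs, hA, hsA, Subset.rfl, Subset.rfl, ?_⟩
      rintro _ hy hsy hyA ⟨H, rfl, hPH⟩
      exact hH ⟨H, hy, hsy, hyA, hPH⟩
  obtain ⟨n, hn⟩ := hP ⟨y, hy.nonempty, isClosed_discrete y⟩
  exact hyP n ⟨_, rfl, hn⟩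

theorem not_semiStratifiable_CL_nat : ¬ SemiStratifiable (CL ℕ) := by
  rintro ⟨F, hF, hmono⟩
  let D : CL ℕ → Opens (CL ℕ) := fun H => ⟨{K | K.1 ⊆ H.1}, CL.isOpen_subset (isOpen_discrete _)⟩
  refine CL.not_cover_of_forall_exists_nhds (fun n H => H ∈ F n (D H)) (fun H => ?_) ?_
  · have hH : H ∈ (D H : Set (CL ℕ)) := Subset.refl H.1
    rw [hF] at hH
    exact mem_iUnion.1 hH
  · intro n H _
    let V : Opens (CL ℕ) := ⟨{H}ᶜ, isOpen_compl_singleton⟩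
    refine ⟨(F n V : Set (CL ℕ))ᶜ, (F n V).2.isOpen_compl.mem_nhds fun hH => ?_, fun K hK hKP => ?_⟩
    · have hHV : H ∈ (V : Set (CL ℕ)) := by
        rw [hF]
        exact mem_iUnion.2 ⟨n, hH⟩
      exact hHV rfl
    · by_contra hHK
      refine hK (hmono n (D K) V ?_ hKP)
      rintro L hLK rfl
      exact hHK hLK

theorem not_quasiDevelopable_CL_nat : ¬ QuasiDevelopable (CL ℕ) := by
  rintro ⟨𝓤, ho, hU⟩
  refine CL.not_cover_of_forall_exists_nhds
    (fun n H => H ∈ starAt H (𝓤 n) ∧ starAt H (𝓤 n) ⊆ {K | K.1 ⊆ H.1})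
    (fun H => hU H _ (CL.isOpen_subset (isOpen_discrete _)) (Subset.refl H.1)) ?_
  rintro n H ⟨⟨W, ⟨hW, hHW⟩, -⟩, -⟩
  exact ⟨W, (ho n W hW).mem_nhds hHW, fun K hKW hK => hK.2 ⟨W, ⟨hW, hKW⟩, hHW⟩⟩

/-- At a point of countable character, the balls of a symmetric are neighbourhoods: a sequence
converging to `p` outside a ball around `p` would have closed range. -/
theorem IsSymmetric.ball_mem_nhds {Y : Type*} [TopologicalSpace Y] [T2Space Y] {d : Y → Y → ℝ}
    (hs : IsSymmetric d)
    (hd : ∀ U : Set Y, IsOpen U ↔ ∀ x ∈ U, ∃ ε > 0, {y | d x y < ε} ⊆ U)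
    (p : Y) [(𝓝 p).IsCountablyGenerated] {ε : ℝ} (hε : 0 < ε) : {y | d p y < ε} ∈ 𝓝 p := by
  by_contra hn
  have hfr : ∃ᶠ y in 𝓝 p, ¬ d p y < ε := Filter.not_eventually.1 hn
  obtain ⟨x, hx, hxε⟩ := Filter.exists_seq_forall_of_frequently hfr
  have hpx : p ∉ range x := by
    rintro ⟨n, hn⟩
    refine hxε n ?_
    rwa [hn, (hs.2.1 p p).2 rfl]
  have hopen : IsOpen (range x)ᶜ := by
    refine (hd _).2 fun y hy => ?_
    by_cases hyp : y = p
    · subst hyp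
      refine ⟨ε, hε, ?_⟩
      rintro _ hz ⟨n, rfl⟩
      exact hxε n hz
    · have hc : IsOpen (insert p (range x))ᶜ :=
        hx.isCompact_insert_range.isClosed.isOpen_compl
      obtain ⟨δ, hδ, hb⟩ := (hd _).1 hc y (by simp_all)
      exact ⟨δ, hδ, hb.trans (compl_subset_compl.2 (subset_insert p _))⟩
  obtain ⟨n, hn⟩ := (hx.eventually (hopen.mem_nhds hpx)).exists
  exact hn ⟨n, rfl⟩

theorem not_symmetrizable_CL_nat : ¬ Symmetrizable (CL ℕ) := by
  rintro ⟨d, hs, hd⟩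
  refine CL.not_cover_of_forall_exists_nhds
    (fun n H => {K | d H K < 1 / ((n : ℝ) + 1)} ⊆ {K | K.1 ⊆ H.1}) (fun H => ?_) ?_
  · obtain ⟨ε, hε, hb⟩ := (hd _).1 (CL.isOpen_subset (isOpen_discrete H.1)) H (Subset.refl H.1)
    obtain ⟨n, hn⟩ := exists_nat_one_div_lt hε
    exact ⟨n, fun K hK => hb (lt_trans hK hn)⟩
  · intro n H _
    refine ⟨{K | d H K < 1 / ((n : ℝ) + 1)}, hs.ball_mem_nhds hd H Nat.one_div_pos_of_nat,
      fun K hHK hK => hK ?_⟩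
    rw [mem_ofPred_eq, hs.2.2]
    exact hHK

theorem CL.isClosed_range_of_min (x : ℕ → CL ℕ) (hx : ∀ n, n ∈ (x n).1)
    (hx' : ∀ n, (x n).1 ⊆ Ici n) :
    IsClosed (range x) := by
  rw [← isOpen_compl_iff, isOpen_iff_mem_nhds]
  intro H hH
  obtain ⟨m, hm, hmin⟩ : ∃ m, IsLeast H.1 m :=
    ⟨sInf H.1, Nat.sInf_mem H.2.1, fun _ h => Nat.sInf_le h⟩
  have hne : H ∈ ({x m}ᶜ : Set (CL ℕ)) := fun h => hH ⟨m, h.symm⟩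
  filter_upwards [(CL.isOpen_inter_nonempty (isOpen_discrete {m})).mem_nhds ⟨m, hm, rfl⟩,
    (CL.isOpen_subset (isOpen_discrete H.1)).mem_nhds (Subset.refl H.1),
    isOpen_compl_singleton.mem_nhds hne]
  rintro _ ⟨b, hb, rfl⟩ hsub hne' ⟨k, rfl⟩
  have hk : k = b := le_antisymm (hx' k hb) (hmin (hsub (hx k)))
  exact hne' (hk ▸ rfl)

/-- The final segments of `ℕ` form a closed set without a countable base of neighbourhoods: from
the `n`-th neighbourhood a proper subset of `[n, ∞)` with least element `n` can be chosen, and the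
sets so chosen form a closed set. -/
theorem not_isD1Space_CL_nat : ¬ IsD1Space (CL ℕ) := by
  intro h
  let e : ℕ → CL ℕ := fun n => ⟨Ici n, nonempty_Ici, isClosed_discrete _⟩
  obtain ⟨𝓑, hc, hB, hbase⟩ := h (range e) (range_nonempty e)
    (CL.isClosed_range_of_min e (fun n => le_refl n) fun n => Subset.rfl)
  obtain ⟨B₀, hB₀, -⟩ := hbase univ isOpen_univ (subset_univ _)
  obtain ⟨B, rfl⟩ := hc.exists_eq_range ⟨B₀, hB₀⟩
  have hex : ∀ n, ∃ K : CL ℕ, K ∈ B n ∧ n ∈ K.1 ∧ K.1 ⊆ Ici n ∧ K.1.Finite := by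
    intro n
    obtain ⟨hBo, heB⟩ := hB (B n) ⟨n, rfl⟩
    obtain ⟨F, hF, hFe, hFB⟩ := CL.exists_finite_of_isOpen hBo (heB ⟨n, rfl⟩)
    have hsub : insert n F ⊆ Ici n := insert_subset (le_refl n) hFe
    exact ⟨⟨insert n F, insert_nonempty n F, isClosed_discrete _⟩,
      hFB _ (subset_insert n F) hsub, mem_insert n F, hsub, hF.insert n⟩
  choose x hxB hx hx' hxf using hex
  obtain ⟨_, ⟨n, rfl⟩, hn⟩ :=
    hbase (range x)ᶜ (CL.isClosed_range_of_min x hx hx').isOpen_compl (by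
      rintro _ ⟨n, rfl⟩ ⟨k, hk⟩
      refine Ici_infinite n ?_
      have := hxf k
      rwa [hk] at this)
  exact hn (hxB n) ⟨n, rfl⟩

/-! ### Countable compactness -/

/-- A `T₁` space that is not countably compact contains a closed discrete copy of `ℕ`. -/
theorem exists_isClosedEmbedding_nat {X : Type*} [TopologicalSpace X] [T1Space X]
    (h : ¬ CountablyCompactSpace X) : ∃ f : ℕ → X, IsClosedEmbedding f := by
  rw [← isCountablyCompact_univ_iff, isCountablyCompact_iff_infinite_subset_has_accPt] at h
  push Not at h
  obtain ⟨B, -, hB, hacc⟩ := h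
  refine ⟨fun n => hB.natEmbedding B n, .of_continuous_injective_isClosedMap
    continuous_of_discreteTopology (Subtype.val_injective.comp (hB.natEmbedding B).injective) ?_⟩
  intro s _
  refine (isClosed_iff_derivedSet_subset _).2 fun a ha => ?_
  refine absurd (AccPt.mono ha (principal_mono.2 ?_)) (hacc a (mem_univ a))
  rintro _ ⟨n, -, rfl⟩
  exact (hB.natEmbedding B n).2

theorem countablyCompactSpace_of_not_CL_nat {X : Type*} [TopologicalSpace X] [T1Space X]
    (h : ∀ f : CL ℕ → CL X, ¬ IsClosedEmbedding f) : CountablyCompactSpace X := by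
  by_contra hX
  obtain ⟨f, hf⟩ := exists_isClosedEmbedding_nat hX
  exact h _ (CL.isClosedEmbedding_image hf)

theorem finite_of_forall_subset_isClosed {X : Type*} [TopologicalSpace X] [CountablyCompactSpace X]
    {D : Set X} (hD : ∀ S ⊆ D, IsClosed S) : D.Finite := by
  by_contra hinf
  obtain ⟨a, -, ha⟩ := CountablyCompactSpace.isCountablyCompact_univ.exists_accPt_of_infinite
    (subset_univ D) hinf
  rw [accPt_principal_iff_clusterPt] at ha
  exact (isClosed_iff_clusterPt.1 (hD (D \ {a}) sdiff_subset) a ha).2 rfl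

/-- In a countably compact space, countably many neighbourhoods of `K` whose closures have no points
in common outside `K` generate the neighbourhood filter of `K`. -/
theorem isCountablyGenerated_nhdsSet {Y : Type*} [TopologicalSpace Y] [CountablyCompactSpace Y]
    {ι : Type*} [Countable ι] {K : Set Y} (W : ι → Set Y) (hW : ∀ i, W i ∈ 𝓝ˢ K)
    (hK : ⋂ i, closure (W i) ⊆ K) : (𝓝ˢ K).IsCountablyGenerated := by
  have heq : 𝓝ˢ K = ⨅ i, 𝓟 (W i) := by
    refine le_antisymm (le_iInf fun i => le_principal_iff.2 (hW i)) fun O hO => ?_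
    obtain ⟨V, hV, hKV, hVO⟩ := mem_nhdsSet_iff_exists.1 hO
    obtain ⟨t, ht⟩ := (hV.isClosed_compl.isCountablyCompact).elim_finite_subcover
      (U := fun i => (closure (W i))ᶜ) (fun i => isClosed_closure.isOpen_compl)
      (by rw [← compl_iInter]; exact compl_subset_compl.2 (hK.trans hKV))
    have hmem : ⋂ i ∈ t, W i ∈ ⨅ i, 𝓟 (W i) :=
      (Filter.biInter_finset_mem t).2 fun i _ => mem_iInf_of_mem i (mem_principal_self _)
    refine mem_of_superset hmem fun y hy => hVO ?_
    by_contra hyV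
    obtain ⟨i, hi, hyi⟩ := mem_iUnion₂.1 (ht hyV)
    exact hyi (subset_closure (mem_iInter₂.1 hy i hi))
  rw [heq]
  exact isCountablyGenerated_seq W

/-- A covering principle. Let the index set of a cover `U` of `K` be well-ordered, and assume that
each point of `U i` is attached to `i` at some level `n`. If, for each level, any choice of points
attached to their first index involves only countably many indices, then `U` has a countable
subcover. -/
theorem exists_countable_subcover {X ι : Type*} [LinearOrder ι] [WellFoundedLT ι] {K : Set X}
    (U : ι → Set X) (hU : K ⊆ ⋃ i, U i) (T : ℕ → X → ι → Prop)
    (hT : ∀ i, ∀ x ∈ U i, ∃ n, T n x i)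
    (h : ∀ (n : ℕ) (A : Set ι) (p : ι → X), InjOn p A →
      (∀ i ∈ A, p i ∈ K ∧ p i ∈ U i ∧ (∀ j < i, p i ∉ U j) ∧ T n (p i) i) → A.Countable) :
    ∃ A : Set ι, A.Countable ∧ K ⊆ ⋃ i ∈ A, U i := by
  rcases K.eq_empty_or_nonempty with rfl | ⟨x₀, -⟩
  · exact ⟨∅, countable_empty, empty_subset _⟩
  have : Nonempty X := ⟨x₀⟩
  let A : ℕ → Set ι := fun n => {i | ∃ x ∈ K, x ∈ U i ∧ (∀ j < i, x ∉ U j) ∧ T n x i}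
  refine ⟨⋃ n, A n, countable_iUnion fun n => ?_, fun x hx => ?_⟩
  · have hA : ∀ i ∈ A n, ∃ x ∈ K, x ∈ U i ∧ (∀ j < i, x ∉ U j) ∧ T n x i := fun i hi => hi
    choose! p hp using hA
    refine h n (A n) p (fun i hi j hj hij => ?_) hp
    rcases lt_trichotomy i j with hlt | heq | hlt
    · exact absurd (hij ▸ (hp i hi).2.1) ((hp j hj).2.2.1 i hlt)
    · exact heq
    · exact absurd (hij ▸ (hp j hj).2.1) ((hp i hi).2.2.1 j hlt)
  · obtain ⟨i, hi, hmin⟩ := exists_minimal_of_wellFoundedLT (fun i => x ∈ U i) (mem_iUnion.1 (hU hx))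
    have hmin' : ∀ j < i, x ∉ U j := fun j hj hxj => (hmin hxj hj.le).not_gt hj
    obtain ⟨n, hn⟩ := hT i x hi
    exact mem_iUnion₂.2 ⟨i, mem_iUnion.2 ⟨n, x, hx, hi, hmin', hn⟩, hi⟩

/-! ### Countably compact semi-stratifiable spaces -/

/-- For an open cover `U` indexed by a well-order, points of `F n (U i)` lying in no earlier member
of the cover form a closed discrete set as `i` varies: around a point with first index `i`, the set
`U i \ F n (⋃ j < i, U j)` is a neighbourhood that contains at most the point chosen for `i`. -/
theorem SemiStratifiable.compactSpace {X : Type*} [TopologicalSpace X] [T1Space X]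
    [CountablyCompactSpace X] (h : SemiStratifiable X) : CompactSpace X := by
  obtain ⟨F, hF, hmono⟩ := h
  have hFsub (n : ℕ) (V : Opens X) : (F n V : Set X) ⊆ V := by
    rw [hF V]
    exact subset_iUnion (fun n => (F n V : Set X)) n
  have hL : IsLindelof (univ : Set X) := by
    refine isLindelof_of_countable_subcover fun {ι} U hUo hU => ?_
    obtain ⟨_, _⟩ := exists_wellFoundedLT ι
    let V : ι → Opens X := fun i => ⟨U i, hUo i⟩
    refine exists_countable_subcover U hU (fun n x i => x ∈ F n (V i)) (fun i x hx => ?_) ?_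
    · have hx' : x ∈ (V i : Set X) := hx
      rw [hF] at hx'
      exact mem_iUnion.1 hx'
    · intro n A p hinj hp
      refine Finite.countable (Finite.of_finite_image ?_ hinj)
      refine finite_of_forall_subset_isClosed fun S hS => ?_
      rw [← isOpen_compl_iff, isOpen_iff_mem_nhds]
      intro z hz
      obtain ⟨i, hi, hmin⟩ :=
        exists_minimal_of_wellFoundedLT (fun i => z ∈ U i) (mem_iUnion.1 (hU (mem_univ z)))
      have hmin' : ∀ j < i, z ∉ U j := fun j hj hzj => (hmin hzj hj.le).not_gt hj
      let E : Opens X := ⨆ j : Iio i, V j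
      have hzE : z ∉ F n E := fun hzF => by
        obtain ⟨j, hj⟩ := Opens.mem_iSup.1 (hFsub n E hzF)
        exact hmin' j j.2 hj
      have hp' : ∀ j ∈ A, p j ∈ U i → p j ∉ F n E → j = i := by
        intro j hj hji hjE
        rcases lt_trichotomy j i with hlt | heq | hlt
        · have hle : V j ≤ E := le_iSup (fun j : Iio i => V j) ⟨j, hlt⟩
          exact absurd (hmono n _ _ hle (hp j hj).2.2.2) hjE
        · exact heq
        · exact absurd hji ((hp j hj).2.2.1 i hlt)
      have hN : U i ∩ (F n E : Set X)ᶜ ∈ 𝓝 z :=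
        ((hUo i).inter (F n E).2.isOpen_compl).mem_nhds ⟨hi, hzE⟩
      by_cases hiS : p i ∈ S
      · have hzi : z ≠ p i := fun hzi => hz (hzi ▸ hiS)
        filter_upwards [hN, isOpen_compl_singleton.mem_nhds hzi] with y hy hyi hyS
        obtain ⟨j, hj, rfl⟩ := hS hyS
        exact hyi (by rw [hp' j hj hy.1 hy.2]; rfl)
      · filter_upwards [hN] with y hy hyS
        obtain ⟨j, hj, rfl⟩ := hS hyS
        exact hiS (by rwa [hp' j hj hy.1 hy.2] at hyS)
  have : LindelofSpace X := ⟨hL⟩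
  exact LindelofSpace.compactSpace

/-- The diagonal of a semi-stratifiable Hausdorff space is the intersection of countably many
unions of open squares, so for a compact space its neighbourhood filter, which is a uniformity, is
countably generated. -/
theorem SemiStratifiable.metrizableSpace {X : Type*} [TopologicalSpace X] [T2Space X]
    [CompactSpace X] (h : SemiStratifiable X) : MetrizableSpace X := by
  obtain ⟨F, hF, hmono⟩ := h
  let P : X → Opens X := fun x => ⟨{x}ᶜ, isOpen_compl_singleton⟩
  let g : ℕ → X → Set X := fun n x => (F n (P x) : Set X)ᶜ
  have hg (n : ℕ) (x : X) : IsOpen (g n x) := (F n (P x)).2.isOpen_compl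
  have hxg (n : ℕ) (x : X) : x ∈ g n x := fun hx => by
    have hx' : x ∈ (P x : Set X) := by
      rw [hF]
      exact mem_iUnion.2 ⟨n, hx⟩
    exact hx' rfl
  have hgU (n : ℕ) (V : Opens X) (x y : X) (hy : y ∈ F n V) (hyx : y ∈ g n x) : x ∈ V := by
    by_contra hxV
    refine hyx (hmono n V (P x) ?_ hy)
    rintro z hz rfl
    exact hxV hz
  let G : ℕ × ℕ → Set (X × X) := fun k =>
    ⋃ x, (g k.1 x ∩ g k.2 x) ×ˢ (g k.1 x ∩ g k.2 x)
  have hG (k : ℕ × ℕ) : IsOpen (G k) := isOpen_iUnion fun x =>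
    ((hg _ x).inter (hg _ x)).prod ((hg _ x).inter (hg _ x))
  have hdG (k : ℕ × ℕ) : diagonal X ⊆ G k := by
    rintro ⟨x, y⟩ hxy
    obtain rfl : x = y := hxy
    exact mem_iUnion.2 ⟨x, ⟨hxg _ x, hxg _ x⟩, hxg _ x, hxg _ x⟩
  choose W hWo hdW hWG using fun k => normal_exists_closure_subset isClosed_diagonal (hG k) (hdG k)
  have hcg : (𝓝ˢ (diagonal X)).IsCountablyGenerated := by
    refine isCountablyGenerated_nhdsSet W (fun k => (hWo k).mem_nhdsSet.2 (hdW k)) ?_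
    rintro ⟨y, z⟩ hyz
    by_contra hne
    obtain ⟨U, V, hU, hV, hyU, hzV, hUV⟩ := t2_separation (show y ≠ z from hne)
    have hyU' : y ∈ ((⟨U, hU⟩ : Opens X) : Set X) := hyU
    have hzV' : z ∈ ((⟨V, hV⟩ : Opens X) : Set X) := hzV
    rw [hF] at hyU' hzV'
    obtain ⟨n, hn⟩ := mem_iUnion.1 hyU'
    obtain ⟨m, hm⟩ := mem_iUnion.1 hzV'
    obtain ⟨x, hx, hx'⟩ := mem_iUnion.1 (hWG (n, m) (mem_iInter.1 hyz (n, m)))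
    exact Set.disjoint_left.1 hUV (hgU n _ x y hn hx.1) (hgU m _ x z hm hx'.2)
  let _ : UniformSpace X := uniformSpaceOfCompactR1
  have : (uniformity X).IsCountablyGenerated := by
    rwa [← nhdsSet_diagonal_eq_uniformity]
  exact { toPseudoMetrizableSpace := inferInstance, toT0Space := inferInstance }

/-! ### Semi-stratifiability of `X` from the properties of `CL X` -/

/-- The neighbourhoods `W` of `K` in a quasi-development of `CL X` give open sets
`{x | {x} ∪ K ∈ W}`, whose intersection is `K`. -/
theorem isGδ_of_quasiDevelopable_CL {X : Type*} [TopologicalSpace X] [T1Space X]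
    (h : QuasiDevelopable (CL X)) {K : Set X} (hK : IsClosed K) : IsGδ K := by
  rcases K.eq_empty_or_nonempty with rfl | hne
  · exact isOpen_empty.isGδ
  obtain ⟨𝓤, ho, hU⟩ := h
  let K' : CL X := ⟨K, hne, hK⟩
  let G : ℕ → Set X := fun n => {x | ∃ W ∈ 𝓤 n, K' ∈ W ∧ CL.adjoin K' x ∈ W}
  let I : Set ℕ := {n | K' ∈ starAt K' (𝓤 n)}
  have hKG : K = ⋂ n ∈ I, G n := by
    refine Subset.antisymm (fun x hx => mem_iInter₂.2 fun n hn => ?_) fun x hx => ?_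
    · obtain ⟨W, ⟨hW, hKW⟩, -⟩ := hn
      have hKx : CL.adjoin K' x = K' := Subtype.ext (union_eq_right.2 (singleton_subset_iff.2 hx))
      exact ⟨W, hW, hKW, by rwa [hKx]⟩
    · by_contra hxK
      obtain ⟨n, hn, hnU⟩ := hU K' {H | H.1 ⊆ {x}ᶜ}
        (CL.isOpen_subset isOpen_compl_singleton) (subset_compl_singleton_iff.2 hxK)
      obtain ⟨W, hW, hKW, hxW⟩ := mem_iInter₂.1 hx n hn
      have hsub : (CL.adjoin K' x).1 ⊆ {x}ᶜ := hnU ⟨W, ⟨hW, hKW⟩, hxW⟩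
      exact hsub (Or.inl rfl) rfl
  rw [hKG]
  refine IsGδ.biInter I.to_countable fun n _ => IsOpen.isGδ ?_
  have hG : G n = ⋃ W ∈ {W ∈ 𝓤 n | K' ∈ W}, CL.adjoin K' ⁻¹' W := by
    ext x
    simp [G, and_assoc]
  rw [hG]
  exact isOpen_biUnion fun W hW => (ho n W hW.1).preimage (CL.continuous_adjoin K')

/-- A quasi-developable space with closed `Gδ` sets is semi-stratifiable: write the union of the
`n`-th family as a union of closed sets `C k`, and let `F n k U` consist of the points of `C k` whose
`n`-th star lies in `U`. -/
theorem QuasiDevelopable.semiStratifiable {X : Type*} [TopologicalSpace X]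
    (h : QuasiDevelopable X) (hG : ∀ K : Set X, IsClosed K → IsGδ K) : SemiStratifiable X := by
  obtain ⟨𝓤, ho, hU⟩ := h
  have hO (n : ℕ) : IsOpen (⋃₀ 𝓤 n) := isOpen_sUnion (ho n)
  choose G hGo hGeq using fun n => isGδ_iff_eq_iInter_nat.1 (hG _ (hO n).isClosed_compl)
  let E : ℕ × ℕ → Set X → Set X := fun k U => {x | x ∉ G k.1 k.2 ∧ starAt x (𝓤 k.1) ⊆ U}
  have hE (k : ℕ × ℕ) (U : Set X) : IsClosed (E k U) := by
    have hEc : (E k U)ᶜ = G k.1 k.2 ∪ ⋃ W ∈ {W ∈ 𝓤 k.1 | ¬ W ⊆ U}, W := by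
      ext x
      simp only [E, starAt, mem_compl_iff, mem_ofPred_eq, not_and_or, not_not, mem_union,
        sUnion_subset_iff, mem_iUnion, exists_prop]
      refine or_congr_right ?_
      push Not
      exact ⟨fun ⟨W, hW, hWU⟩ => ⟨W, ⟨hW.1, hWU⟩, hW.2⟩,
        fun ⟨W, hW, hxW⟩ => ⟨W, ⟨hW.1, hxW⟩, hW.2⟩⟩
    rw [← isOpen_compl_iff, hEc]
    exact (hGo _ _).union (isOpen_biUnion fun W hW => ho _ W hW.1)
  refine ⟨fun m U => ⟨E (Nat.unpair m) U, hE _ _⟩, fun U => ?_, ?_⟩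
  · refine Subset.antisymm (fun x hx => ?_) (iUnion_subset fun m x hx => ?_)
    · obtain ⟨n, hxn, hn⟩ := hU x U U.2 hx
      obtain ⟨W, ⟨hW, hxW⟩, -⟩ := hxn
      have hxO : x ∉ ⋂ k, G n k := by
        rw [← hGeq n]
        exact fun hx' => hx' ⟨W, hW, hxW⟩
      obtain ⟨k, hk⟩ := not_forall.1 (mt mem_iInter.2 hxO)
      refine mem_iUnion.2 ⟨Nat.pair n k, ?_⟩
      change x ∈ E (Nat.unpair (Nat.pair n k)) U
      rw [Nat.unpair_pair]
      exact ⟨hk, hn⟩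
    · obtain ⟨hxG, hst⟩ := (hx : x ∈ E (Nat.unpair m) U)
      have hxO : x ∉ (⋃₀ 𝓤 (Nat.unpair m).1)ᶜ := by
        rw [hGeq]
        exact fun hx' => hxG (mem_iInter.1 hx' _)
      obtain ⟨W, hW, hxW⟩ := not_not.1 hxO
      exact hst ⟨W, ⟨hW, hxW⟩, hxW⟩
  · intro m V U hVU x hx
    exact ⟨hx.1, hx.2.trans hVU⟩

/-- Let `B n` be a base of neighbourhoods in `CL X` of the set of singletons. Then `F n U` consists of
the points `x` such that `{x, y} ∈ B n` implies `y ∈ U`. -/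
theorem IsD1Space.semiStratifiable_of_CL {X : Type*} [TopologicalSpace X] [T2Space X]
    (h : IsD1Space (CL X)) : SemiStratifiable X := by
  rcases isEmpty_or_nonempty X with hX | hX
  · exact ⟨fun _ _ => ⊥, fun U => Subsingleton.elim _ _, fun _ _ _ _ => le_rfl⟩
  obtain ⟨𝓑, hc, hB, hbase⟩ := h (range CL.single) (range_nonempty _)
    (CL.isClosedEmbedding_single X).isClosed_range
  obtain ⟨B₀, hB₀, -⟩ := hbase univ isOpen_univ (subset_univ _)
  obtain ⟨B, rfl⟩ := hc.exists_eq_range ⟨B₀, hB₀⟩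
  let E : ℕ → Set X → Set X := fun n U => {x | ∀ y ∉ U, CL.adjoin (CL.single y) x ∉ B n}
  have hE (n : ℕ) (U : Set X) : IsClosed (E n U) := by
    simp only [E, ofPred_forall]
    exact isClosed_iInter fun y => isClosed_iInter fun _ =>
      ((hB _ ⟨n, rfl⟩).1.preimage (CL.continuous_adjoin (CL.single y))).isClosed_compl
  refine ⟨fun n U => ⟨E n U, hE n U⟩, fun U => ?_, fun n V U hVU x hx y hy =>
    hx y fun hyV => hy (hVU hyV)⟩
  refine Subset.antisymm (fun x hx => ?_) (iUnion_subset fun n x hx => ?_)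
  · have hO : IsOpen ({H : CL X | H.1 ⊆ U} ∪ {H : CL X | H.1 ⊆ {x}ᶜ}) :=
      (CL.isOpen_subset U.2).union (CL.isOpen_subset isOpen_compl_singleton)
    obtain ⟨_, ⟨n, rfl⟩, hn⟩ := hbase _ hO (by
      rintro _ ⟨y, rfl⟩
      by_cases hyx : y = x
      · exact Or.inl (singleton_subset_iff.2 (hyx ▸ hx))
      · exact Or.inr (singleton_subset_iff.2 hyx))
    refine mem_iUnion.2 ⟨n, fun y hy hyB => ?_⟩
    rcases hn hyB with hsub | hsub
    · exact hy (hsub (Or.inr rfl))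
    · exact hsub (Or.inl rfl) rfl
  · by_contra hxU
    refine hx x hxU ?_
    have hxx : CL.adjoin (CL.single x) x = CL.single x := Subtype.ext (union_self _)
    rw [hxx]
    exact (hB _ ⟨n, rfl⟩).2 ⟨x, rfl⟩

/-- Cover the complement of `p` by open sets whose closures miss `p`. For this cover, the points
selected at one level accumulate at most at `p`, so only finitely many of them lie outside each ball
around `p`, and a countable subcover exists. The complements of the closures of its members then
generate the neighbourhood filter of `p`. -/
theorem IsSymmetric.isCountablyGenerated_nhds {X : Type*} [TopologicalSpace X] [T2Space X]
    [CountablyCompactSpace X] {d : X → X → ℝ} (hs : IsSymmetric d)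
    (hd : ∀ U : Set X, IsOpen U ↔ ∀ x ∈ U, ∃ ε > 0, {y | d x y < ε} ⊆ U) (p : X) :
    (𝓝 p).IsCountablyGenerated := by
  obtain ⟨h0, heq, hsymm⟩ := hs
  have hpos : ∀ {x y : X}, x ≠ y → 0 < d x y := fun hxy =>
    lt_of_le_of_ne (h0 _ _) fun h => hxy ((heq _ _).1 h.symm)
  have hex : ∀ q : {q : X // q ≠ p}, ∃ V : Set X, IsOpen V ∧ q.1 ∈ V ∧ p ∉ closure V := by
    rintro ⟨q, hq⟩
    obtain ⟨V, W, hV, hW, hqV, hpW, hVW⟩ := t2_separation hq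
    exact ⟨V, hV, hqV, fun hp => Set.disjoint_left.1 (hVW.closure_left hW) hp hpW⟩
  choose U hUo hUq hUp using hex
  obtain ⟨_, _⟩ := exists_wellFoundedLT {q : X // q ≠ p}
  have hcov : ({p}ᶜ : Set X) ⊆ ⋃ i, U i := fun q hq => mem_iUnion.2 ⟨⟨q, hq⟩, hUq _⟩
  obtain ⟨A, hA, hAcov⟩ := exists_countable_subcover U hcov
    (fun n x i => {y | d x y < 1 / ((n : ℝ) + 1)} ⊆ U i)
    (fun i x hx => by
      obtain ⟨ε, hε, hb⟩ := (hd _).1 (hUo i) x hx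
      obtain ⟨n, hn⟩ := exists_nat_one_div_lt hε
      exact ⟨n, fun y hy => hb (lt_trans hy hn)⟩)
    (fun n A q hinj hq => by
      have hAk : A ⊆ ⋃ k : ℕ, {i ∈ A | 1 / ((k : ℝ) + 1) < d p (q i)} := by
        intro i hi
        obtain ⟨k, hk⟩ := exists_nat_one_div_lt (hpos (Ne.symm (hq i hi).1))
        exact mem_iUnion.2 ⟨k, hi, hk⟩
      refine (countable_iUnion fun k => Finite.countable ?_).mono hAk
      refine Finite.of_finite_image ?_ (hinj.mono (sep_subset _ _))
      refine finite_of_forall_subset_isClosed fun S hS => ?_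
      rw [← isOpen_compl_iff, hd]
      intro y hy
      by_cases hyp : y = p
      · subst hyp
        refine ⟨_, Nat.one_div_pos_of_nat (n := k), fun z hz hzS => ?_⟩
        obtain ⟨i, hi, rfl⟩ := hS hzS
        exact lt_asymm hz hi.2
      · obtain ⟨i, hi, hmin⟩ :=
          exists_minimal_of_wellFoundedLT (fun i => y ∈ U i) (mem_iUnion.1 (hcov hyp))
        have hmin' : ∀ j < i, y ∉ U j := fun j hj hyj => (hmin hyj hj.le).not_gt hj
        obtain ⟨δ, hδ, hb⟩ := (hd _).1 (hUo i) y hi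
        -- In a ball of this radius around `y` only the point selected for `i` can occur.
        have key : ∀ z, d y z < min δ (1 / ((n : ℝ) + 1)) → z ∈ S → z = q i := by
          intro z hz hzS
          obtain ⟨j, hj, rfl⟩ := hS hzS
          obtain ⟨-, -, hjmin, hjb⟩ := hq j hj.1
          rcases lt_trichotomy j i with hlt | rfl | hlt
          · refine absurd (hjb ?_) (hmin' j hlt)
            rw [mem_ofPred_eq, hsymm]
            exact hz.trans_le (min_le_right _ _)
          · rfl
          · exact absurd (hb (hz.trans_le (min_le_left _ _))) (hjmin i hlt)
        have hr : 0 < min δ (1 / ((n : ℝ) + 1)) := lt_min hδ Nat.one_div_pos_of_nat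
        by_cases hqi : q i ∈ S
        · have hyq : y ≠ q i := fun h => hy (h ▸ hqi)
          refine ⟨_, lt_min hr (hpos hyq), fun z hz hzS => ?_⟩
          have hzq := key z (lt_of_lt_of_le hz (min_le_left _ _)) hzS
          have hlt : d y z < d y (q i) := lt_of_lt_of_le hz (min_le_right _ _)
          exact absurd hlt (hzq ▸ lt_irrefl _)
        · exact ⟨_, hr, fun z hz hzS => hqi (key z hz hzS ▸ hzS)⟩)
  have := hA.to_subtype
  rw [← nhdsSet_singleton]
  refine isCountablyGenerated_nhdsSet (fun i : A => (closure (U i))ᶜ) (fun i => ?_) fun y hy => ?_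
  · rw [nhdsSet_singleton]
    exact isClosed_closure.isOpen_compl.mem_nhds (hUp i)
  · by_contra hyp
    obtain ⟨i, hi, hyi⟩ := mem_iUnion₂.1 (hAcov hyp)
    have hdis : Disjoint (closure (closure (U i))ᶜ) (U i) :=
      (disjoint_compl_left_iff_subset.2 subset_closure).closure_left (hUo i)
    exact Set.disjoint_left.1 hdis (mem_iInter.1 hy ⟨i, hi⟩) hyi

/-- All balls of the symmetric are neighbourhoods of their centres. Let `F n U` be the complement of
the union of the interiors of the balls of radius `1 / (n + 1)` around the points outside `U`. -/
theorem Symmetrizable.semiStratifiable {X : Type*} [TopologicalSpace X] [T2Space X]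
    [CountablyCompactSpace X] (h : Symmetrizable X) : SemiStratifiable X := by
  obtain ⟨d, hs, hd⟩ := h
  have hball (n : ℕ) (x : X) : x ∈ interior {y | d x y < 1 / ((n : ℝ) + 1)} :=
    have := hs.isCountablyGenerated_nhds hd x
    mem_interior_iff_mem_nhds.2 (hs.ball_mem_nhds hd x Nat.one_div_pos_of_nat)
  refine ⟨fun n U => ⟨(⋃ x ∈ (U : Set X)ᶜ, interior {y | d x y < 1 / ((n : ℝ) + 1)})ᶜ,
    (isOpen_biUnion fun _ _ => isOpen_interior).isClosed_compl⟩, fun U => ?_, fun n V U hVU => ?_⟩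
  · refine Subset.antisymm (fun x hx => ?_) (iUnion_subset fun n x hx => ?_)
    · obtain ⟨ε, hε, hb⟩ := (hd U).1 U.2 x hx
      obtain ⟨n, hn⟩ := exists_nat_one_div_lt hε
      refine mem_iUnion.2 ⟨n, fun hx' => ?_⟩
      obtain ⟨y, hy, hxy⟩ := mem_iUnion₂.1 hx'
      have hlt : x ∈ {z | d y z < 1 / ((n : ℝ) + 1)} := interior_subset hxy
      refine hy (hb ?_)
      rw [mem_ofPred_eq, hs.2.2]
      exact hlt.trans hn
    · by_contra hxU
      exact hx (mem_iUnion₂.2 ⟨x, hxU, hball n x⟩)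
  · exact compl_subset_compl.2 (biUnion_subset_biUnion_left (compl_subset_compl.2 hVU))

end VietorisHyperspace

open VietorisHyperspace in
theorem theorem5p1 (X : Type u) [TopologicalSpace X] [T3Space X] :
    List.TFAE [
      VietorisHyperspace.SemiStratifiable (VietorisHyperspace.CL X),
      VietorisHyperspace.QuasiDevelopable (VietorisHyperspace.CL X),
      VietorisHyperspace.IsD1Space (VietorisHyperspace.CL X),
      VietorisHyperspace.Symmetrizable (VietorisHyperspace.CL X),
      CompactSpace X ∧ TopologicalSpace.MetrizableSpace X] := by
  have hsing := CL.isClosedEmbedding_single X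
  have key : CountablyCompactSpace X → SemiStratifiable X →
      CompactSpace X ∧ MetrizableSpace X := fun _ h =>
    have := h.compactSpace
    ⟨this, h.metrizableSpace⟩
  tfae_have 1 → 5 := fun h =>
    key (countablyCompactSpace_of_not_CL_nat fun _ hf =>
      not_semiStratifiable_CL_nat (h.of_isInducing hf.isInducing))
      (h.of_isInducing hsing.isInducing)
  tfae_have 2 → 5 := fun h =>
    key (countablyCompactSpace_of_not_CL_nat fun _ hf =>
      not_quasiDevelopable_CL_nat (h.of_isInducing hf.isInducing))
      ((h.of_isInducing hsing.isInducing).semiStratifiable fun _ => isGδ_of_quasiDevelopable_CL h)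
  tfae_have 3 → 5 := fun h =>
    key (countablyCompactSpace_of_not_CL_nat fun _ hf =>
      not_isD1Space_CL_nat (h.of_isClosedEmbedding hf)) h.semiStratifiable_of_CL
  tfae_have 4 → 5 := fun h =>
    have hc : CountablyCompactSpace X := countablyCompactSpace_of_not_CL_nat fun _ hf =>
      not_symmetrizable_CL_nat (h.of_isClosedEmbedding hf)
    key hc (h.of_isClosedEmbedding hsing).semiStratifiable
  tfae_have 5 → 1 := fun ⟨_, _⟩ =>
    have := (CL.compactSpace_and_metrizableSpace (X := X)).2
    semiStratifiable_of_metrizableSpace _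
  tfae_have 5 → 2 := fun ⟨_, _⟩ =>
    have := (CL.compactSpace_and_metrizableSpace (X := X)).2
    quasiDevelopable_of_metrizableSpace _
  tfae_have 5 → 3 := fun ⟨_, _⟩ =>
    have := (CL.compactSpace_and_metrizableSpace (X := X)).1
    have := (CL.compactSpace_and_metrizableSpace (X := X)).2
    isD1Space_of_metrizableSpace _
  tfae_have 5 → 4 := fun ⟨_, _⟩ =>
    have := (CL.compactSpace_and_metrizableSpace (X := X)).2
    symmetrizable_of_metrizableSpace _
  tfae_finish
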